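/- All graphs are finite and simple. For a graph $G$, let $A(G)$ be its adjacency matrix, $D(G)$ the diagonal matrix of its vertex degrees, and $q(G)$ the largest eigenvalue of the signless Laplacian matrix $Q(G)=D(G)+A(G)$. Write $C_\ell$ for the cycle of length $\ell$ with vertices $v_1,\dots,v_\ell$ in cyclic order. For positive integers $n_1,\dots,n_\ell$, the blow-up $C_\ell\circ(n_1,\dots,n_\ell)$ is the graph obtained from $C_\ell$ by replacing each vertex $v_i$ with an independent set $V_i$ of $n_i$ vertices and joining every vertex of $V_i$ to every vertex of $V_j$ whenever $v_iv_j\in E(C_\ell)$. **Theorem 1.2.** Let $k\ge 2$ and $n\ge 2k+3$ be integers, and let $G$ be a non-bipartite graph of order $n$ that contains none of the cycles $C_3,C_5,\dots,C_{2k+1}$ as a (not necessarily induced) subgraph. Then $$q(G)\le q\bigl(C_{2k+3}\circ(n-2k-2,1,\dots,1)\bigr),$$ and equality holds if and only if $G\cong C_{2k+3}\circ(n-2k-2,1,\dots,1)$. -/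

import Mathlib

noncomputable section

namespace QIndex

/-- The signless Laplacian matrix `Q(G) = D(G) + A(G)`, with real entries. -/
def signlessLaplacian {V : Type*} [Fintype V] [DecidableEq V] (G : SimpleGraph V)
    [DecidableRel G.Adj] : Matrix V V ℝ :=
  G.degMatrix ℝ + G.adjMatrix ℝ

open Classical in
/-- The `Q`-index `q(G)`: the largest eigenvalue of the signless Laplacian matrix of `G`.
For a nonempty vertex set the supremum is attained, see `isGreatest_qIndex`. -/
def qIndex {V : Type*} [Fintype V] (G : SimpleGraph V) : ℝ :=
  sSup {μ : ℝ | Module.End.HasEigenvalue (Matrix.toLin' (signlessLaplacian G)) μ}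

open Classical in
theorem isGreatest_qIndex {V : Type*} [Fintype V] [Nonempty V] (G : SimpleGraph V) :
    IsGreatest {μ : ℝ | Module.End.HasEigenvalue (Matrix.toLin' (signlessLaplacian G)) μ}
      (qIndex G) := by
  have hA : (signlessLaplacian G).IsHermitian :=
    (G.isHermitian_degMatrix (R := ℝ)).add (G.isHermitian_adjMatrix (R := ℝ))
  have hs : {μ : ℝ | Module.End.HasEigenvalue (Matrix.toLin' (signlessLaplacian G)) μ}
      = Set.range hA.eigenvalues := by
    ext μ
    rw [← hA.spectrum_real_eq_range_eigenvalues, ← Matrix.spectrum_toLin']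
    exact Module.End.hasEigenvalue_iff_mem_spectrum
  have hf : (Set.range hA.eigenvalues).Finite := Set.finite_range _
  have hne : (Set.range hA.eigenvalues).Nonempty := Set.range_nonempty _
  unfold qIndex
  rw [hs]
  exact ⟨hne.csSup_mem hf, fun _ h => le_csSup hf.bddAbove h⟩

/-- The blow-up `H ∘ r`: each vertex `v` of `H` is replaced by an independent set of `r v`
vertices, and two vertices in the sets of `v` and `w` are adjacent exactly if `v` and `w` are
adjacent in `H`. -/
def blowUp {V : Type*} (H : SimpleGraph V) (r : V → ℕ) : SimpleGraph (Σ v : V, Fin (r v)) where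
  Adj x y := H.Adj x.1 y.1
  symm := ⟨fun _ _ h => H.adj_symm h⟩
  loopless := ⟨fun x h => H.loopless.irrefl x.1 h⟩

/-- The vector `(m, 1, …, 1)` of length `l`. -/
def headVector (l m : ℕ) : Fin l → ℕ := fun i => if i.val = 0 then m else 1

end QIndex

end

/-! Suppose `q = q(G)` is at least the value for the extremal graph, and put `m = n - 2k - 2`. The
moduli `|x u + x v|` of the edge sums of an eigenvector, scaled to have maximum 1 over the edges,
satisfy `q f(ab) ≤ ∑ f(aw) + ∑ f(bw)`, the sums running over the edges at `a` and at `b`. At an edge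
`uv` of weight 1 this gives `q ≤ d(u) + d(v)`, while a test vector on the extremal graph gives `q >
m + 2`. Hence `d(u) + d(v) ≥ m + 3`.

A shortest odd cycle has length `g ≥ 2k + 3 ≥ 7` and contains at most two neighbours of any vertex.
As `u` and `v` have no common neighbour, `d(u) + d(v) ≤ n - g + 4`. The two bounds meet, so `g = 2k
+ 3`, each of `u`, `v` has two neighbours on the cycle, and their neighbourhoods together with the
cycle cover `G`. This rigidity folds `G` onto the cycle (`exists_fold`), with singleton fibres
except perhaps four consecutive ones, whose sizes `a, b, c, d` add up to `m + 3`.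

The largest weights on the edge classes of the folding obey a cyclic system of inequalities
(`exists_class_weights`). Together with `q (m + 3 - q) ≤ 1` it forces three of `a, b, c, d` to be 1
(`three_fibres_eq_one`). So `G` is a spanning subgraph of the extremal graph. Monotonicity of `q`,
strict because the extremal graph is connected, settles the bound and the equality case. -/

namespace QIndex

/-! ### Quadratic form and monotonicity of the `Q`-index -/

section Spectral

variable {V W : Type*} [Fintype V] [Fintype W]

open Classical in
theorem signlessLaplacian_mulVec (G : SimpleGraph V) (x : V → ℝ) (u : V) :
    (signlessLaplacian G).mulVec x u = ∑ w with G.Adj u w, (x u + x w) := by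
  have h : G.neighborFinset u = Finset.univ.filter (G.Adj u) := by ext w; simp
  rw [signlessLaplacian, Matrix.add_mulVec, Pi.add_apply, SimpleGraph.adjMatrix_mulVec_apply,
    SimpleGraph.degMatrix, Matrix.mulVec_diagonal, Finset.sum_add_distrib, Finset.sum_const,
    nsmul_eq_mul, h, ← SimpleGraph.card_neighborFinset_eq_degree, h]

open Classical in
theorem signlessLaplacian_isHermitian (G : SimpleGraph V) : (signlessLaplacian G).IsHermitian :=
  (G.isHermitian_degMatrix (R := ℝ)).add (G.isHermitian_adjMatrix (R := ℝ))

open Classical in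
theorem exists_eigenvector_qIndex [Nonempty V] (G : SimpleGraph V) :
    ∃ x : V → ℝ, x ≠ 0 ∧ ∀ u, ∑ w with G.Adj u w, (x u + x w) = qIndex G * x u := by
  obtain ⟨x, hx⟩ := (isGreatest_qIndex G).1.exists_hasEigenvector
  refine ⟨x, hx.2, fun u => ?_⟩
  rw [← signlessLaplacian_mulVec]
  have := congrFun hx.apply_eq_smul u
  simpa using this

open Classical in
theorem posSemidef_qIndex_sub [Nonempty V] (G : SimpleGraph V) :
    (qIndex G • (1 : Matrix V V ℝ) - signlessLaplacian G).PosSemidef := by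
  have hA : (qIndex G • (1 : Matrix V V ℝ) - signlessLaplacian G).IsHermitian := by
    refine Matrix.IsHermitian.sub ?_ (signlessLaplacian_isHermitian G)
    simp [Matrix.IsHermitian]
  rw [hA.posSemidef_iff_eigenvalues_nonneg]
  intro i
  have h := hA.mulVec_eigenvectorBasis i
  set y : V → ℝ := ⇑(hA.eigenvectorBasis i) with hy
  have hy0 : y ≠ 0 := by
    intro h0
    refine hA.eigenvectorBasis.orthonormal.ne_zero i ?_
    ext u
    exact congrFun h0 u
  have key : Module.End.HasEigenvalue (Matrix.toLin' (signlessLaplacian G))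
      (qIndex G - hA.eigenvalues i) := by
    refine Module.End.hasEigenvalue_of_hasEigenvector (x := y) ⟨?_, hy0⟩
    rw [Module.End.mem_eigenspace_iff, Matrix.toLin'_apply, sub_smul, ← h, Matrix.sub_mulVec,
      Matrix.smul_mulVec, Matrix.one_mulVec]
    abel
  have := (isGreatest_qIndex G).2 key
  simp only [Pi.zero_apply]
  linarith

open Classical in
/-- The quadratic form of the signless Laplacian. -/
noncomputable def quadForm (G : SimpleGraph V) (x : V → ℝ) : ℝ :=
  ∑ u, x u * ∑ w with G.Adj u w, (x u + x w)

open Classical in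
theorem two_mul_quadForm (G : SimpleGraph V) (x : V → ℝ) :
    2 * quadForm G x = ∑ u, ∑ w, if G.Adj u w then (x u + x w) ^ 2 else 0 := by
  have h1 : quadForm G x = ∑ u, ∑ w, if G.Adj u w then x u * (x u + x w) else 0 := by
    simp only [quadForm, Finset.mul_sum, Finset.sum_filter]
    simp
  have h2 : quadForm G x = ∑ u, ∑ w, if G.Adj u w then x w * (x u + x w) else 0 := by
    rw [h1, Finset.sum_comm]
    refine Finset.sum_congr rfl fun u _ => Finset.sum_congr rfl fun w _ => ?_
    simp only [G.adj_comm w u, add_comm]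
  rw [two_mul]
  nth_rewrite 1 [h1]
  rw [h2, ← Finset.sum_add_distrib]
  refine Finset.sum_congr rfl fun u _ => ?_
  rw [← Finset.sum_add_distrib]
  refine Finset.sum_congr rfl fun w _ => ?_
  split_ifs <;> ring

open Classical in
theorem dotProduct_qIndex_sub [Nonempty V] (G : SimpleGraph V) (x : V → ℝ) :
    star x ⬝ᵥ (qIndex G • (1 : Matrix V V ℝ) - signlessLaplacian G).mulVec x
      = qIndex G * ∑ u, x u ^ 2 - quadForm G x := by
  simp only [dotProduct, Matrix.sub_mulVec, Matrix.smul_mulVec, Matrix.one_mulVec, Pi.sub_apply,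
    Pi.smul_apply, signlessLaplacian_mulVec, quadForm, star_trivial, smul_eq_mul,
    Finset.mul_sum (a := qIndex G),
    ← Finset.sum_sub_distrib]
  exact Finset.sum_congr rfl fun u _ => by ring

theorem quadForm_le [Nonempty V] (G : SimpleGraph V) (x : V → ℝ) :
    quadForm G x ≤ qIndex G * ∑ u, x u ^ 2 := by
  classical
  have := (posSemidef_qIndex_sub G).dotProduct_mulVec_nonneg x
  rw [dotProduct_qIndex_sub] at this
  linarith

open Classical in
theorem eigenvector_of_quadForm_eq [Nonempty V] (G : SimpleGraph V) (x : V → ℝ)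
    (h : quadForm G x = qIndex G * ∑ u, x u ^ 2) (u : V) :
    ∑ w with G.Adj u w, (x u + x w) = qIndex G * x u := by
  have h0 := (posSemidef_qIndex_sub G).dotProduct_mulVec_zero_iff x
  rw [dotProduct_qIndex_sub, h, sub_self] at h0
  have h1 := congrFun (h0.1 rfl) u
  rw [Matrix.sub_mulVec, Matrix.smul_mulVec, Matrix.one_mulVec, Pi.sub_apply,
    signlessLaplacian_mulVec] at h1
  simp only [Pi.smul_apply, smul_eq_mul, Pi.zero_apply] at h1
  linarith

theorem sum_sq_pos {x : V → ℝ} (hx : x ≠ 0) : 0 < ∑ u, x u ^ 2 := by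
  obtain ⟨u, hu⟩ := Function.ne_iff.1 hx
  exact Finset.sum_pos' (fun _ _ => sq_nonneg _) ⟨u, Finset.mem_univ u, by
    have : x u ≠ 0 := hu
    positivity⟩

open Classical in
/-- A nonnegative vector `z` with `Q z ≥ t z` bounds the `Q`-index from below by `t`. -/
theorem le_qIndex_of_subeigenvector [Nonempty V] (G : SimpleGraph V) {z : V → ℝ} {t : ℝ}
    (hz : ∀ u, 0 ≤ z u) (hz0 : z ≠ 0)
    (h : ∀ u, t * z u ≤ ∑ w with G.Adj u w, (z u + z w)) : t ≤ qIndex G := by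
  have h1 : t * ∑ u, z u ^ 2 ≤ quadForm G z := by
    rw [quadForm, Finset.mul_sum]
    exact Finset.sum_le_sum fun u _ => by
      nlinarith [h u, hz u, mul_le_mul_of_nonneg_left (h u) (hz u)]
  exact le_of_mul_le_mul_right (h1.trans (quadForm_le G z)) (sum_sq_pos hz0)

open Classical in
/-- For an eigenvector of the `Q`-index, the moduli of its edge sums form a subeigenvector of the
edge version of the signless Laplacian. -/
theorem qIndex_mul_abs_add_le {G : SimpleGraph V} {x : V → ℝ} (hq : 0 ≤ qIndex G)
    (hx : ∀ u, ∑ w with G.Adj u w, (x u + x w) = qIndex G * x u) (u v : V) :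
    qIndex G * |x u + x v| ≤
      ∑ w with G.Adj u w, |x u + x w| + ∑ w with G.Adj v w, |x v + x w| := by
  have h : qIndex G * |x u + x v| = |qIndex G * x u + qIndex G * x v| := by
    rw [← mul_add, abs_mul, abs_of_nonneg hq]
  rw [h, ← hx u, ← hx v]
  exact (abs_add_le _ _).trans (add_le_add (Finset.abs_sum_le_sum_abs _ _)
    (Finset.abs_sum_le_sum_abs _ _))

/-- Vanishing of a nonnegative vector at one vertex spreads along edges. -/
def ZeroSpreads (H : SimpleGraph W) : Prop :=
  ∀ s : Set W, s.Nonempty → (∀ a ∈ s, ∀ b, H.Adj a b → b ∈ s) → ∀ a, a ∈ s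

open Classical in
-- Passing to `|x|` does not decrease any `(x u + x v) ^ 2`, and additional edges contribute
-- nonnegative terms.
theorem quadForm_le_quadForm_of_hom {G : SimpleGraph V} {H : SimpleGraph W} (e : V ≃ W)
    (he : ∀ u v, G.Adj u v → H.Adj (e u) (e v)) (x : V → ℝ) :
    quadForm G x ≤ quadForm H fun w => |x (e.symm w)| := by
  suffices h : 2 * quadForm G x ≤ 2 * quadForm H fun w => |x (e.symm w)| by linarith
  rw [two_mul_quadForm, two_mul_quadForm, ← e.sum_comp]
  refine Finset.sum_le_sum fun u _ => ?_
  rw [← e.sum_comp]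
  refine Finset.sum_le_sum fun v _ => ?_
  simp only [Equiv.symm_apply_apply]
  split_ifs with h1 h2
  · rw [← sq_abs]
    exact pow_le_pow_left₀ (abs_nonneg _) (abs_add_le _ _) 2
  · exact absurd (he u v h1) h2
  · positivity
  · exact le_rfl

open Classical in
theorem qIndex_le_of_hom [Nonempty V] {G : SimpleGraph V} {H : SimpleGraph W} (e : V ≃ W)
    (he : ∀ u v, G.Adj u v → H.Adj (e u) (e v)) : qIndex G ≤ qIndex H := by
  have : Nonempty W := e.symm.nonempty
  obtain ⟨x, hx0, hx⟩ := exists_eigenvector_qIndex G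
  have h1 : quadForm G x = qIndex G * ∑ u, x u ^ 2 := by
    rw [quadForm, Finset.mul_sum]
    exact Finset.sum_congr rfl fun u _ => by rw [hx]; ring
  have h2 : ∑ w, |x (e.symm w)| ^ 2 = ∑ u, x u ^ 2 := by
    rw [← e.sum_comp]; simp
  have h3 := (quadForm_le_quadForm_of_hom e he x).trans (quadForm_le H _)
  rw [h1, h2] at h3
  exact le_of_mul_le_mul_right h3 (sum_sq_pos hx0)

open Classical in
-- Equality makes `|x|` an eigenvector of `H`. Its zeros would spread to all of `H`, so it is
-- positive everywhere, and an edge of `H` missing from `G` would add a strictly positive square.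
theorem adj_iff_of_hom_of_qIndex_eq [Nonempty V] {G : SimpleGraph V} {H : SimpleGraph W}
    (e : V ≃ W) (he : ∀ u v, G.Adj u v → H.Adj (e u) (e v)) (hH : ZeroSpreads H)
    (hq : qIndex G = qIndex H) (u v : V) : H.Adj (e u) (e v) ↔ G.Adj u v := by
  refine ⟨fun huv => ?_, he u v⟩
  by_contra hG
  have : Nonempty W := e.symm.nonempty
  obtain ⟨x, hx0, hx⟩ := exists_eigenvector_qIndex G
  have h1 : quadForm G x = qIndex G * ∑ u, x u ^ 2 := by
    rw [quadForm, Finset.mul_sum]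
    exact Finset.sum_congr rfl fun u _ => by rw [hx]; ring
  have h2 : ∑ w, |x (e.symm w)| ^ 2 = ∑ u, x u ^ 2 := by
    rw [← e.sum_comp]; simp
  have h3 := quadForm_le_quadForm_of_hom e he x
  have h4 := quadForm_le H fun w => |x (e.symm w)|
  rw [h2, ← hq, ← h1] at h4
  have h5 := eigenvector_of_quadForm_eq H (fun w => |x (e.symm w)|)
    (by rw [h2, ← hq, ← h1]; exact le_antisymm h4 h3)
  have hpos : ∀ w, x (e.symm w) ≠ 0 := by
    by_contra! hne
    refine hx0 (funext fun a => ?_)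
    have := hH {w | x (e.symm w) = 0} hne (fun a ha b hab => ?_) (e a)
    · simpa using this
    · have ha' : x (e.symm a) = 0 := ha
      have h6 := h5 a
      simp only [ha', abs_zero, zero_add, mul_zero] at h6
      rw [Finset.sum_eq_zero_iff_of_nonneg (fun _ _ => abs_nonneg _)] at h6
      simpa using h6 b (by simpa using hab)
  have h6 : 2 * quadForm G x < 2 * quadForm H fun w => |x (e.symm w)| := by
    rw [two_mul_quadForm, two_mul_quadForm, ← e.sum_comp]
    have hle : ∀ a b, (if G.Adj a b then (x a + x b) ^ 2 else 0) ≤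
        if H.Adj (e a) (e b) then (|x (e.symm (e a))| + |x (e.symm (e b))|) ^ 2 else 0 := by
      intro a b
      simp only [Equiv.symm_apply_apply]
      split_ifs with h1 h2
      · rw [← sq_abs]
        exact pow_le_pow_left₀ (abs_nonneg _) (abs_add_le _ _) 2
      · exact absurd (he a b h1) h2
      · positivity
      · exact le_rfl
    refine Finset.sum_lt_sum (fun a _ => ?_) ⟨u, Finset.mem_univ u, ?_⟩
    · rw [← e.sum_comp]
      exact Finset.sum_le_sum fun b _ => hle a b
    · rw [← e.sum_comp]
      refine Finset.sum_lt_sum (fun b _ => hle u b) ⟨v, Finset.mem_univ v, ?_⟩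
      rw [if_neg hG, if_pos huv]
      have := abs_pos.2 (hpos (e u))
      have := abs_pos.2 (hpos (e v))
      positivity
  linarith

end Spectral

/-! ### Lower bound for the extremal graph -/

section Extremal

open Classical in
theorem sum_blowUp_adj {V : Type*} [Fintype V] (H : SimpleGraph V) (r : V → ℕ) (F : V → ℝ)
    (x : Σ v : V, Fin (r v)) :
    ∑ y with (blowUp H r).Adj x y, F y.1 = ∑ j with H.Adj x.1 j, r j * F j := by
  rw [Finset.sum_filter, Finset.sum_filter, Fintype.sum_sigma]
  refine Finset.sum_congr rfl fun j _ => ?_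
  by_cases h : H.Adj x.1 j <;> simp [blowUp, h]

theorem cycleGraph_adj_zmod (k : ℕ) (i j : ZMod (2 * k + 3)) :
    (SimpleGraph.cycleGraph (2 * k + 3)).Adj i j ↔ i - j = 1 ∨ j - i = 1 := Iff.rfl

theorem fin_val_sub_one (k : ℕ) (i : Fin (2 * k + 3)) :
    (i - 1).val = if i.val = 0 then 2 * k + 2 else i.val - 1 := by
  rw [Fin.val_sub, Fin.val_one]
  have := i.2
  split_ifs with h
  · rw [h, Nat.mod_eq_of_lt (by omega)]; omega
  · rw [show 2 * k + 3 - 1 + i.val = (i.val - 1) + (2 * k + 3) by omega, Nat.add_mod_right,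
      Nat.mod_eq_of_lt (by omega)]

theorem fin_val_add_one (k : ℕ) (i : Fin (2 * k + 3)) :
    (i + 1).val = if i.val = 2 * k + 2 then 0 else i.val + 1 := by
  rw [Fin.val_add, Fin.val_one]
  have := i.2
  split_ifs with h
  · rw [h]; exact Nat.mod_self _
  · exact Nat.mod_eq_of_lt (by omega)

theorem sum_cycleGraph_adj (k : ℕ) (F : Fin (2 * k + 3) → ℝ) (i : Fin (2 * k + 3))
    [DecidablePred ((SimpleGraph.cycleGraph (2 * k + 3)).Adj i)] :
    ∑ j with (SimpleGraph.cycleGraph (2 * k + 3)).Adj i j, F j = F (i - 1) + F (i + 1) := by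
  have h : Finset.univ.filter ((SimpleGraph.cycleGraph (2 * k + 3)).Adj i) = {i - 1, i + 1} := by
    ext j
    have := SimpleGraph.cycleGraph_neighborFinset (n := 2 * k + 1) (v := i)
    rw [← this]
    simp
  rw [h, Finset.sum_pair]
  intro h
  have h2 := congrArg Fin.val h
  rw [fin_val_sub_one, fin_val_add_one] at h2
  have := i.2
  split_ifs at h2 <;> omega

/-- The weights of a subeigenvector of the extremal graph along its cycle. -/
noncomputable def extremalWeight (k : ℕ) (t : ℝ) (i : ℕ) : ℝ :=
  if i = 0 then 2 else if i = 1 ∨ i = 2 * k + 2 then t - 2 else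
    if i = 2 ∨ i = 2 * k + 1 then 1 else 0

theorem extremalWeight_nonneg {k : ℕ} {t : ℝ} (ht : 2 ≤ t) (i : ℕ) : 0 ≤ extremalWeight k t i := by
  unfold extremalWeight
  split_ifs <;> linarith

/-- The weights turn the row of the large fibre into an identity, and the rows of its two neighbours
into `t ^ 2 + 1 = (m + 3) t`. At distance two the only slack is the next weight, and beyond that the
left side is 0. -/
theorem le_qIndex_extremal {k m : ℕ} (hk : 2 ≤ k) {t : ℝ} (ht : 2 ≤ t)
    (htm : t ^ 2 + 1 = (m + 3) * t) (hm : 1 ≤ m) :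
    t ≤ qIndex (blowUp (SimpleGraph.cycleGraph (2 * k + 3)) (headVector (2 * k + 3) m)) := by
  have : Nonempty (Σ i : Fin (2 * k + 3), Fin (headVector (2 * k + 3) m i)) :=
    ⟨⟨0, ⟨0, by simp [headVector]; omega⟩⟩⟩
  refine le_qIndex_of_subeigenvector _ (z := fun x => extremalWeight k t x.1.val)
    (fun _ => extremalWeight_nonneg ht _) ?_ ?_
  · intro h
    have := congrFun h ⟨0, ⟨0, by simp [headVector]; omega⟩⟩
    simp [extremalWeight] at this
  · intro x
    classical
    rw [sum_blowUp_adj (SimpleGraph.cycleGraph (2 * k + 3)) (headVector (2 * k + 3) m)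
      (fun j : Fin (2 * k + 3) => extremalWeight k t x.1.val + extremalWeight k t j.val) x,
      sum_cycleGraph_adj]
    simp only [headVector, fin_val_sub_one, fin_val_add_one]
    have hi := x.1.2
    generalize x.1.val = i at hi
    have hw := fun j => extremalWeight_nonneg (k := k) ht j
    have w0 : extremalWeight k t 0 = 2 := by simp [extremalWeight]
    have w1 : extremalWeight k t 1 = t - 2 := by simp [extremalWeight]
    have w1' : extremalWeight k t (2 * k + 2) = t - 2 := by simp [extremalWeight]
    have w2 : extremalWeight k t 2 = 1 := by
      simp [extremalWeight]; omega
    have w2' : extremalWeight k t (2 * k + 1) = 1 := by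
      simp [extremalWeight]; omega
    by_cases h0 : i = 0
    · subst h0
      simp [w0, w1, w1']; linarith
    by_cases h1 : i = 1
    · subst h1
      simp [w0, w1, w2]; nlinarith
    by_cases h2 : i = 2 * k + 2
    · subst h2
      simp [w0, w1', w2']; nlinarith
    by_cases h3 : i = 2
    · subst h3
      have : k ≠ 0 := by omega
      simp [w1, w2, this]
      linarith [hw 3]
    by_cases h4 : i = 2 * k + 1
    · subst h4
      have : 2 * k ≠ 0 := by omega
      simp [w1', w2', this]
      linarith [hw (2 * k)]
    · have h5 : extremalWeight k t i = 0 := by simp [extremalWeight, h0, h1, h2, h3, h4]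
      simp only [h5]
      have := hw (i - 1)
      have := hw (i + 1)
      simp only [h0, h2, if_false, mul_zero, zero_add]
      positivity

/-- The `Q`-index of the extremal graph is at least the larger root of `t ^ 2 - (m + 3) t + 1`. -/
theorem qIndex_extremal_bounds {k m : ℕ} (hk : 2 ≤ k) (hm : 1 ≤ m) {q : ℝ}
    (hq : qIndex (blowUp (SimpleGraph.cycleGraph (2 * k + 3)) (headVector (2 * k + 3) m)) ≤ q) :
    (m : ℝ) + 2 < q ∧ q * ((m + 3) - q) ≤ 1 := by
  have hm' : (1 : ℝ) ≤ m := by exact_mod_cast hm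
  set t : ℝ := ((m + 3) + √((m + 3) ^ 2 - 4)) / 2 with ht
  have hs : √((m + 3 : ℝ) ^ 2 - 4) ^ 2 = (m + 3) ^ 2 - 4 := Real.sq_sqrt (by nlinarith)
  have hs0 := Real.sqrt_nonneg ((m + 3 : ℝ) ^ 2 - 4)
  have hs1 : (m : ℝ) + 1 < √((m + 3 : ℝ) ^ 2 - 4) := Real.lt_sqrt_of_sq_lt (by nlinarith)
  have h1 : t ^ 2 + 1 = (m + 3) * t := by rw [ht]; nlinarith
  have h2 : (m : ℝ) + 2 < t := by rw [ht]; linarith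
  have h3 := (le_qIndex_extremal hk (by linarith) h1 hm).trans hq
  exact ⟨by linarith, by nlinarith⟩

theorem zmod_induction {g : ℕ} [NeZero g] {P : ZMod g → Prop} {i : ZMod g} (hi : P i)
    (hP : ∀ l, P l → P (l + 1)) (j : ZMod g) : P j := by
  have key : ∀ n : ℕ, P (i + n) := by
    intro n
    induction n with
    | zero => simpa using hi
    | succ n ih =>
      have := hP _ ih
      rwa [add_assoc, ← Nat.cast_succ] at this
  have := key (j - i).val
  rwa [ZMod.natCast_zmod_val, add_sub_cancel] at this

theorem fin_induction {k : ℕ} {P : Fin (2 * k + 3) → Prop} {i : Fin (2 * k + 3)} (hi : P i)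
    (hP : ∀ l, P l → P (l + 1)) (j : Fin (2 * k + 3)) : P j :=
  zmod_induction (g := 2 * k + 3) hi hP j

theorem zeroSpreads_extremal {k m : ℕ} (hm : 1 ≤ m) :
    ZeroSpreads (blowUp (SimpleGraph.cycleGraph (2 * k + 3)) (headVector (2 * k + 3) m)) := by
  rintro s ⟨⟨i, a⟩, hs⟩ hadj ⟨j, b⟩
  have hpos : ∀ l : Fin (2 * k + 3), 0 < headVector (2 * k + 3) m l := by
    intro l; simp only [headVector]; split_ifs <;> omega
  have hadd : ∀ l : Fin (2 * k + 3), (SimpleGraph.cycleGraph (2 * k + 3)).Adj l (l + 1) :=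
    fun l => SimpleGraph.cycleGraph_adj.2 (Or.inr (add_sub_cancel_left l 1))
  -- The start is `i + 1`, since only one vertex of fibre `i` is known to lie in `s`; the rest of
  -- that fibre is reached after a full turn.
  refine fin_induction (P := fun l => ∀ c : Fin (headVector (2 * k + 3) m l),
    (⟨l, c⟩ : Σ v, Fin (headVector (2 * k + 3) m v)) ∈ s) (i := i + 1)
    (fun c => hadj ⟨i, a⟩ hs _ (hadd i)) (fun l hl c => hadj ⟨l, ⟨0, hpos l⟩⟩ (hl _) _ (hadd l)) j b

end Extremal

/-! ### Shortest odd cycles -/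

section OddCycle

variable {V : Type*} {G : SimpleGraph V} {g : ℕ} {c : ZMod g → V}

/-- `c` runs around a closed walk of odd length `g`, and no closed walk of odd length is shorter. -/
structure IsShortestOddCycle (G : SimpleGraph V) (g : ℕ) (c : ZMod g → V) : Prop where
  odd : Odd g
  adj : ∀ i, G.Adj (c i) (c (i + 1))
  le : ∀ (v : V) (p : G.Walk v v), Odd p.length → g ≤ p.length

theorem exists_isShortestOddCycle (hG : ¬ G.IsBipartite) :
    ∃ (g : ℕ) (c : ZMod g → V), IsShortestOddCycle G g c := by
  classical
  have h : ∃ l : ℕ, Odd l ∧ ∃ (v : V) (p : G.Walk v v), p.length = l := by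
    by_contra! hne
    refine hG (SimpleGraph.two_colorable_iff_forall_loop_even.2 fun v p => ?_)
    by_contra hp
    exact hne p.length (Nat.not_even_iff_odd.1 hp) v p rfl
  obtain ⟨ho, v, p, hp⟩ := Nat.find_spec h
  set g := Nat.find h
  have : NeZero g := ⟨ho.pos.ne'⟩
  refine ⟨g, fun i => p.getVert i.val, ho, fun i => ?_,
    fun w q hq => Nat.find_min' h ⟨hq, w, q, rfl⟩⟩
  have hi := i.val_lt
  have h1 := p.adj_getVert_succ (i := i.val) (by omega)
  by_cases hlast : i.val + 1 = g
  · have h2 : i + 1 = 0 := by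
      rw [← ZMod.natCast_zmod_val i, ← Nat.cast_succ, Nat.succ_eq_add_one, hlast, ZMod.natCast_self]
    rw [h2, ZMod.val_zero, SimpleGraph.Walk.getVert_zero]
    rwa [hlast, p.getVert_of_length_le hp.le] at h1
  · have h2 : (i + 1).val = i.val + 1 := by
      have h3 : i + 1 = ((i.val + 1 : ℕ) : ZMod g) := by simp
      rw [h3, ZMod.val_natCast, Nat.mod_eq_of_lt (by omega)]
    rwa [h2]

namespace IsShortestOddCycle

theorem exists_walk (h : IsShortestOddCycle G g c) (i : ZMod g) (n : ℕ) :
    ∃ p : G.Walk (c i) (c (i + n)), p.length = n := by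
  induction n with
  | zero => exact ⟨(SimpleGraph.Walk.nil).copy rfl (by simp), by simp⟩
  | succ n ih =>
    obtain ⟨p, hp⟩ := ih
    exact ⟨(p.concat (h.adj _)).copy rfl (by push_cast; rw [add_assoc]), by simp [hp]⟩

theorem neZero (h : IsShortestOddCycle G g c) : NeZero g := ⟨h.odd.pos.ne'⟩

/-- A walk between two vertices of a shortest odd cycle cannot be shorter than the arc of the
same parity. -/
theorem exists_int_of_walk (h : IsShortestOddCycle G g c) {i j : ZMod g}
    (p : G.Walk (c i) (c j)) :
    ∃ r : ℤ, -p.length ≤ r ∧ r ≤ p.length ∧ Even (p.length + r) ∧ j = i + r := by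
  have := h.neZero
  obtain ⟨l, hl⟩ : ∃ l, p.length = l := ⟨_, rfl⟩
  obtain ⟨a, ha⟩ := h.odd
  have hs := (j - i).val_lt
  have hj : j = i + ((j - i).val : ZMod g) := by simp
  set s := (j - i).val with hs'
  rcases Nat.even_or_odd (l + s) with hpar | hpar
  -- The arc of length `s` has the parity of the walk, so the complementary arc closes it to an odd
  -- closed walk; minimality of `g` gives `s ≤ l`.
  · obtain ⟨q, hq⟩ := h.exists_walk j (g - s)
    have hi : j + ((g - s : ℕ) : ZMod g) = i := by
      rw [Nat.cast_sub hs.le, ZMod.natCast_self, hj]; ring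
    obtain ⟨b, hb⟩ := hpar
    have := h.le _ (p.append (q.copy rfl (by rw [hi]))) (by
      rw [SimpleGraph.Walk.length_append, SimpleGraph.Walk.length_copy, hl, hq]
      exact ⟨b + a - s, by omega⟩)
    rw [SimpleGraph.Walk.length_append, SimpleGraph.Walk.length_copy, hl, hq] at this
    refine ⟨s, by omega, by omega, ⟨b, by omega⟩, by simpa using hj⟩
  -- Here the arc of length `s` itself closes the walk oddly, so `g - s ≤ l`.
  · obtain ⟨q, hq⟩ := h.exists_walk i s
    obtain ⟨b, hb⟩ := hpar
    have := h.le _ (p.append (q.copy rfl (by rw [← hj])).reverse) (by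
      rw [SimpleGraph.Walk.length_append, SimpleGraph.Walk.length_reverse,
        SimpleGraph.Walk.length_copy, hl, hq]
      exact ⟨b, by omega⟩)
    rw [SimpleGraph.Walk.length_append, SimpleGraph.Walk.length_reverse,
        SimpleGraph.Walk.length_copy, hl, hq] at this
    refine ⟨s - g, by omega, by omega, ⟨b - a, by omega⟩, ?_⟩
    push_cast
    rw [ZMod.natCast_self, sub_zero]
    exact hj

theorem injective (h : IsShortestOddCycle G g c) : Function.Injective c := by
  intro i j hij
  obtain ⟨r, h1, h2, -, h3⟩ :=
    h.exists_int_of_walk ((SimpleGraph.Walk.nil : G.Walk (c i) (c i)).copy rfl hij)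
  simp only [SimpleGraph.Walk.length_copy, SimpleGraph.Walk.length_nil] at h1 h2
  obtain rfl : r = 0 := by omega
  simpa using h3.symm

theorem eq_of_adj (h : IsShortestOddCycle G g c) {i j : ZMod g} (hij : G.Adj (c i) (c j)) :
    j = i + 1 ∨ j = i - 1 := by
  obtain ⟨r, h1, h2, ⟨b, hb⟩, h3⟩ := h.exists_int_of_walk hij.toWalk
  simp only [SimpleGraph.Walk.length_cons, SimpleGraph.Walk.length_nil] at h1 h2 hb
  obtain rfl | rfl : r = 1 ∨ r = -1 := by omega
  · left; simpa using h3
  · right; rw [h3]; push_cast; ring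

theorem eq_of_adj₂ (h : IsShortestOddCycle G g c) {i j : ZMod g} {w : V} (h1 : G.Adj w (c i))
    (h2 : G.Adj w (c j)) : j = i ∨ j = i + 2 ∨ j = i - 2 := by
  obtain ⟨r, h1, h2, ⟨b, hb⟩, h3⟩ := h.exists_int_of_walk (.cons h1.symm h2.toWalk)
  simp only [SimpleGraph.Walk.length_cons, SimpleGraph.Walk.length_nil] at h1 h2 hb
  obtain rfl | rfl | rfl : r = 0 ∨ r = 2 ∨ r = -2 := by omega
  · left; simpa using h3
  · right; left; simpa using h3
  · right; right; rw [h3]; push_cast; ring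

theorem eq_of_adj₃ (h : IsShortestOddCycle G g c) {i j : ZMod g} {w w' : V}
    (h1 : G.Adj w (c i)) (h2 : G.Adj w w') (h3 : G.Adj w' (c j)) :
    j = i + 1 ∨ j = i - 1 ∨ j = i + 3 ∨ j = i - 3 := by
  obtain ⟨r, h1, h2, ⟨b, hb⟩, h3⟩ := h.exists_int_of_walk (.cons h1.symm (.cons h2 h3.toWalk))
  simp only [SimpleGraph.Walk.length_cons, SimpleGraph.Walk.length_nil] at h1 h2 hb
  obtain rfl | rfl | rfl | rfl : r = 1 ∨ r = -1 ∨ r = 3 ∨ r = -3 := by omega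
  · left; simpa using h3
  · right; left; rw [h3]; push_cast; ring
  · right; right; left; simpa using h3
  · right; right; right; rw [h3]; push_cast; ring

theorem adj_of_sub_eq_one (h : IsShortestOddCycle G g c) {i j : ZMod g} (hij : j - i = 1) :
    G.Adj (c i) (c j) := by
  rw [sub_eq_iff_eq_add'.1 hij]
  exact h.adj i

theorem le_of_free (h : IsShortestOddCycle G g c) {k : ℕ}
    (hfree : ∀ j : ℕ, 1 ≤ j → j ≤ k → (SimpleGraph.cycleGraph (2 * j + 1)).Free G) :
    2 * k + 3 ≤ g := by
  by_contra! hlt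
  obtain ⟨a, rfl⟩ := h.odd
  rcases Nat.eq_zero_or_pos a with rfl | ha
  · exact G.loopless.irrefl _ (h.adj 0)
  · obtain ⟨b, rfl⟩ : ∃ b, a = b + 1 := ⟨a - 1, by omega⟩
    refine hfree (b + 1) (by omega) (by omega) ⟨⟨⟨c, fun {i j} hij => ?_⟩, h.injective⟩⟩
    rcases (cycleGraph_adj_zmod b i j).1 hij with h1 | h1
    · exact (h.adj_of_sub_eq_one h1).symm
    · exact h.adj_of_sub_eq_one h1

theorem not_triangle (h : IsShortestOddCycle G g c) (hg : 7 ≤ g) {u v w : V} (h1 : G.Adj u v)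
    (h2 : G.Adj v w) (h3 : G.Adj u w) : False := by
  have := h.le u (.cons h1 (.cons h2 h3.symm.toWalk)) (by simp; decide)
  simp at this
  omega

theorem shift (h : IsShortestOddCycle G g c) (a : ZMod g) :
    IsShortestOddCycle G g fun i => c (i + a) :=
  ⟨h.odd, fun i => by rw [add_right_comm]; exact h.adj _, h.le⟩

theorem reflect (h : IsShortestOddCycle G g c) (a : ZMod g) :
    IsShortestOddCycle G g fun i => c (a - i) :=
  ⟨h.odd, fun i => by
    have := h.adj (a - (i + 1))
    rw [show a - (i + 1) + 1 = a - i by ring] at this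
    exact this.symm, h.le⟩

/-- Separates nearby positions on the cycle. The value 7 is excluded because `g` may be 7, and 8 is
allowed because `g` is odd. -/
theorem natCast_ne_zero (h : IsShortestOddCycle G g c) (hg : 7 ≤ g) {z : ℕ} (h0 : 0 < z)
    (h8 : z ≤ 8) (h7 : z ≠ 7) : (z : ZMod g) ≠ 0 := by
  rw [Ne, ZMod.natCast_eq_zero_iff]
  intro hd
  have := Nat.le_of_dvd h0 hd
  obtain rfl : z = 8 := by omega
  obtain ⟨a, ha⟩ := h.odd
  obtain rfl | rfl : g = 7 ∨ g = 8 := by omega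
  · omega
  · omega

end IsShortestOddCycle

end OddCycle

/-! ### Neighbours on the cycle and folding onto it -/

section Folding

variable {V : Type*} {G : SimpleGraph V} {g : ℕ} {c : ZMod g → V}

namespace IsShortestOddCycle

open Classical in
-- Two distinct neighbours on the cycle differ by `±2`; three of them would force 2 or 6 to vanish
-- modulo `g`.
theorem card_filter_adj_le [NeZero g] (h : IsShortestOddCycle G g c) (hg : 7 ≤ g) (u : V) :
    (Finset.univ.filter fun i => G.Adj u (c i)).card ≤ 2 := by
  by_contra! hlt
  obtain ⟨i, j, l, hi, hj, hl, hij, hil, hjl⟩ := Finset.two_lt_card_iff.1 hlt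
  simp only [Finset.mem_filter, Finset.mem_univ, true_and] at hi hj hl
  have h2 : ((2 : ℕ) : ZMod g) ≠ 0 := h.natCast_ne_zero hg (by norm_num) (by norm_num) (by norm_num)
  have h4 : ((4 : ℕ) : ZMod g) ≠ 0 := h.natCast_ne_zero hg (by norm_num) (by norm_num) (by norm_num)
  have h6 : ((6 : ℕ) : ZMod g) ≠ 0 := h.natCast_ne_zero hg (by norm_num) (by norm_num) (by norm_num)
  have e1 := h.eq_of_adj₂ hi hj
  have e2 := h.eq_of_adj₂ hi hl
  have e3 := h.eq_of_adj₂ hj hl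
  push_cast at h2 h4 h6
  grind

open Classical in
theorem exists_of_card_filter_adj [NeZero g] (h : IsShortestOddCycle G g c) {u : V}
    (hu : (Finset.univ.filter fun i => G.Adj u (c i)).card = 2) :
    ∃ i, ∀ j, G.Adj u (c j) ↔ j = i - 1 ∨ j = i + 1 := by
  obtain ⟨a, b, hab, he⟩ := Finset.card_eq_two.1 hu
  have key : ∀ j, G.Adj u (c j) ↔ j = a ∨ j = b := fun j => by
    simpa using Finset.ext_iff.1 he j
  rcases h.eq_of_adj₂ ((key a).2 (Or.inl rfl)) ((key b).2 (Or.inr rfl)) with h1 | h1 | h1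
  · exact absurd h1.symm hab
  · refine ⟨a + 1, fun j => ?_⟩
    rw [key, h1, add_sub_cancel_right, add_assoc, one_add_one_eq_two]
  · refine ⟨b + 1, fun j => ?_⟩
    rw [key, or_comm, h1, add_sub_cancel_right, add_assoc, one_add_one_eq_two, sub_add_cancel]

open Classical in
-- Inclusion and exclusion for the two neighbourhoods and the cycle; the neighbourhoods are disjoint
-- because there is no triangle.
theorem card_add_card_add_eq [Fintype V] [NeZero g] (h : IsShortestOddCycle G g c) (hg : 7 ≤ g)
    {u v : V} (huv : G.Adj u v) :
    (Finset.univ.filter (G.Adj u)).card + (Finset.univ.filter (G.Adj v)).card + g =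
      (Finset.univ.filter fun w => G.Adj u w ∨ G.Adj v w ∨ ∃ i, c i = w).card +
        (Finset.univ.filter fun i => G.Adj u (c i)).card +
        (Finset.univ.filter fun i => G.Adj v (c i)).card := by
  have hd : ∀ w, ¬ (G.Adj u w ∧ G.Adj v w) := fun w hw => h.not_triangle hg huv hw.2 hw.1
  have hI : ∀ u : V, (Finset.univ.filter fun i => G.Adj u (c i)).card =
      (Finset.univ.filter fun w => G.Adj u w ∧ ∃ i, c i = w).card := by
    intro u
    rw [← Finset.card_image_of_injective _ h.injective]
    congr 1
    ext w
    simp only [Finset.mem_image, Finset.mem_filter, Finset.mem_univ, true_and]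
    constructor
    · rintro ⟨i, hi, rfl⟩; exact ⟨hi, i, rfl⟩
    · rintro ⟨hi, i, rfl⟩; exact ⟨i, hi, rfl⟩
  have hC : (Finset.univ.filter fun w => ∃ i, c i = w).card = g := by
    have h1 : (Finset.univ.filter fun w => ∃ i, c i = w) = Finset.univ.image c := by
      ext w; simp
    rw [h1, Finset.card_image_of_injective _ h.injective, Finset.card_univ, ZMod.card]
  suffices hsum : (Finset.univ.filter (G.Adj u)).card + (Finset.univ.filter (G.Adj v)).card +
      (Finset.univ.filter fun w => ∃ i, c i = w).card =
      (Finset.univ.filter fun w => G.Adj u w ∨ G.Adj v w ∨ ∃ i, c i = w).card +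
        (Finset.univ.filter fun w => G.Adj u w ∧ ∃ i, c i = w).card +
        (Finset.univ.filter fun w => G.Adj v w ∧ ∃ i, c i = w).card by
    rw [hI, hI]; omega
  simp only [Finset.card_filter, ← Finset.sum_add_distrib]
  refine Finset.sum_congr rfl fun w _ => ?_
  have := hd w
  by_cases h1 : G.Adj u w <;> by_cases h2 : G.Adj v w <;> by_cases h3 : ∃ i, c i = w <;>
    simp_all

open Classical in
theorem card_add_card_le [Fintype V] (h : IsShortestOddCycle G g c) (hg : 7 ≤ g) {u v : V}
    (huv : G.Adj u v) :
    (Finset.univ.filter (G.Adj u)).card + (Finset.univ.filter (G.Adj v)).card + g ≤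
      Fintype.card V + 4 := by
  have := h.neZero
  rw [h.card_add_card_add_eq hg huv]
  have h1 := h.card_filter_adj_le hg u
  have h2 := h.card_filter_adj_le hg v
  have h3 := Finset.card_le_univ (Finset.univ.filter fun w => G.Adj u w ∨ G.Adj v w ∨ ∃ i, c i = w)
  omega

open Classical in
theorem exists_cycle_of_card_eq [Fintype V] (h : IsShortestOddCycle G g c) (hg : 7 ≤ g) {u v : V}
    (huv : G.Adj u v)
    (hd : Fintype.card V + 4 ≤
      (Finset.univ.filter (G.Adj u)).card + (Finset.univ.filter (G.Adj v)).card + g) :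
    ∃ c' : ZMod g → V, IsShortestOddCycle G g c' ∧ (∀ i, G.Adj u (c' i) ↔ i = 0 ∨ i = 2) ∧
      (∀ i, G.Adj v (c' i) ↔ i = 1 ∨ i = 3) ∧
      ∀ w, G.Adj u w ∨ G.Adj v w ∨ ∃ i, c' i = w := by
  have := h.neZero
  rw [h.card_add_card_add_eq hg huv] at hd
  have h1 := h.card_filter_adj_le hg u
  have h2 := h.card_filter_adj_le hg v
  have h3 := Finset.card_le_univ (Finset.univ.filter fun w => G.Adj u w ∨ G.Adj v w ∨ ∃ i, c i = w)
  obtain ⟨i, hi⟩ := h.exists_of_card_filter_adj (u := u) (by omega)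
  obtain ⟨j, hj⟩ := h.exists_of_card_filter_adj (u := v) (by omega)
  have hU : (Finset.univ.filter fun w => G.Adj u w ∨ G.Adj v w ∨ ∃ i, c i = w) = Finset.univ :=
    Finset.eq_univ_of_card _ (by omega)
  have hU' : ∀ w, G.Adj u w ∨ G.Adj v w ∨ ∃ i, c i = w := fun w => by
    simpa using Finset.ext_iff.1 hU w
  -- Walks of length three through `u v` allow only the differences `±1` and `±3`. A centre
  -- difference of `±3` would leave two of the neighbours at difference `±5`.
  have hij : j = i + 1 ∨ j = i - 1 := by
    have h2 : ((2 : ℕ) : ZMod g) ≠ 0 := h.natCast_ne_zero hg (by norm_num) (by norm_num) (by norm_num)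
    have h4 : ((4 : ℕ) : ZMod g) ≠ 0 := h.natCast_ne_zero hg (by norm_num) (by norm_num) (by norm_num)
    have h6 : ((6 : ℕ) : ZMod g) ≠ 0 := h.natCast_ne_zero hg (by norm_num) (by norm_num) (by norm_num)
    have h8 : ((8 : ℕ) : ZMod g) ≠ 0 := h.natCast_ne_zero hg (by norm_num) (by norm_num) (by norm_num)
    have e1 := h.eq_of_adj₃ ((hi _).2 (Or.inl rfl)) huv ((hj _).2 (Or.inl rfl))
    have e2 := h.eq_of_adj₃ ((hi _).2 (Or.inl rfl)) huv ((hj _).2 (Or.inr rfl))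
    have e3 := h.eq_of_adj₃ ((hi _).2 (Or.inr rfl)) huv ((hj _).2 (Or.inl rfl))
    push_cast at h2 h4 h6 h8
    grind
  rcases hij with rfl | rfl
  · refine ⟨_, h.shift (i - 1), fun l => ?_, fun l => ?_, fun w => ?_⟩
    · rw [hi]; grind
    · rw [hj]; grind
    · refine (hU' w).imp_right (Or.imp_right fun ⟨l, hl⟩ => ⟨l - (i - 1), by rw [sub_add_cancel, hl]⟩)
  · refine ⟨_, h.reflect (i + 1), fun l => ?_, fun l => ?_, fun w => ?_⟩
    · rw [hi]; grind
    · rw [hj]; grind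
    · refine (hU' w).imp_right (Or.imp_right fun ⟨l, hl⟩ => ⟨i + 1 - l, by rw [sub_sub_cancel, hl]⟩)

/-- If the closed neighbourhoods of an edge `u v` and a shortest odd cycle cover the graph, then the
graph folds onto the cycle, and only four consecutive fibres can be larger than one vertex. -/
theorem exists_fold (h : IsShortestOddCycle G g c) (hg : 7 ≤ g) {u v : V} (huv : G.Adj u v)
    (hu : ∀ i, G.Adj u (c i) ↔ i = 0 ∨ i = 2) (hv : ∀ i, G.Adj v (c i) ↔ i = 1 ∨ i = 3)
    (hcov : ∀ w, G.Adj u w ∨ G.Adj v w ∨ ∃ i, c i = w) :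
    ∃ φ : V → ZMod g, (∀ w w', G.Adj w w' → φ w' = φ w + 1 ∨ φ w = φ w' + 1) ∧
      (∀ i, φ (c i) = i) ∧
      (∀ w, φ w ≠ 0 → φ w ≠ 1 → φ w ≠ 2 → φ w ≠ 3 → w = c (φ w)) ∧ φ u = 1 ∧ φ v = 2 := by
  classical
  have h2 : ((2 : ℕ) : ZMod g) ≠ 0 := h.natCast_ne_zero hg (by norm_num) (by norm_num) (by norm_num)
  have h4 : ((4 : ℕ) : ZMod g) ≠ 0 := h.natCast_ne_zero hg (by norm_num) (by norm_num) (by norm_num)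
  have h6 : ((6 : ℕ) : ZMod g) ≠ 0 := h.natCast_ne_zero hg (by norm_num) (by norm_num) (by norm_num)
  have h8 : ((8 : ℕ) : ZMod g) ≠ 0 := h.natCast_ne_zero hg (by norm_num) (by norm_num) (by norm_num)
  push_cast at h2 h4 h6 h8
  have hnot : ∀ w, G.Adj u w → G.Adj v w → False := fun w a b => h.not_triangle hg huv b a
  choose! ψ hψ using fun w (hw : ∃ i, c i = w) => hw
  have hψc : ∀ i, ψ (c i) = i := fun i => h.injective (hψ _ ⟨i, rfl⟩)
  -- Neighbours of `u` belong at 0 or 2, the positions of its neighbours on the cycle, and adjacency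
  -- to `c (-1)` is what distinguishes 0. Likewise `c 4` distinguishes 3 from 1 for neighbours of
  -- `v`.
  set φ : V → ZMod g := fun w =>
    if G.Adj u w then (if G.Adj w (c (-1)) then 0 else 2)
    else if G.Adj v w then (if G.Adj w (c 4) then 3 else 1) else ψ w with hφ
  have φu : ∀ w, G.Adj u w → φ w = if G.Adj w (c (-1)) then 0 else 2 := fun w hw => by simp [hφ, hw]
  have φv : ∀ w, G.Adj v w → φ w = if G.Adj w (c 4) then 3 else 1 := fun w hw => by
    have : ¬ G.Adj u w := fun hw' => hnot w hw' hw
    simp [hφ, hw, this]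
  have φc : ∀ w, ¬ G.Adj u w → ¬ G.Adj v w → φ w = ψ w := fun w a b => by simp [hφ, a, b]
  have hu0 := (hu 0).2 (Or.inl rfl)
  have hu2 := (hu 2).2 (Or.inr rfl)
  have hv1 := (hv 1).2 (Or.inl rfl)
  have hv3 := (hv 3).2 (Or.inr rfl)
  have edge_uc : ∀ w i, G.Adj u w → ¬ G.Adj v (c i) → G.Adj w (c i) → i = -1 := by
    intro w i hw hvi hwi
    have e1 := h.eq_of_adj₃ hu0 hw hwi
    have e2 := h.eq_of_adj₃ hu2 hw hwi
    norm_num at e1 e2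
    rw [hv] at hvi
    rcases e1 with e | e | e | e
    · exact absurd (Or.inl e) hvi
    · exact e
    · exact absurd (Or.inr e) hvi
    · rcases e2 with f | f | f | f
      · exact absurd (Or.inr f) hvi
      · exact absurd (Or.inl f) hvi
      · exact absurd (by linear_combination e - f) h8
      · exact f
  have edge_vc : ∀ w i, G.Adj v w → ¬ G.Adj u (c i) → G.Adj w (c i) → i = 4 := by
    intro w i hw hui hwi
    have e1 := h.eq_of_adj₃ hv1 hw hwi
    have e2 := h.eq_of_adj₃ hv3 hw hwi
    norm_num at e1 e2
    rw [hu] at hui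
    rcases e1 with e | e | e | e
    · exact absurd (Or.inr e) hui
    · exact absurd (Or.inl e) hui
    · exact e
    · rcases e2 with f | f | f | f
      · exact f
      · exact absurd (Or.inr f) hui
      · exact absurd (by linear_combination e - f) h8
      · exact absurd (Or.inl f) hui
  -- The only bad pair of values is 0 and 3; it would join `c (-1)` to `c 4` by a walk of length
  -- three, across a difference of 5.
  have edge_uv : ∀ w w', G.Adj u w → G.Adj v w' → G.Adj w w' →
      φ w' = φ w + 1 ∨ φ w = φ w' + 1 := by
    intro w w' hw hw' hww
    rw [φu w hw, φv w' hw']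
    by_cases a : G.Adj w (c (-1)) <;> by_cases b : G.Adj w' (c 4)
    · rcases h.eq_of_adj₃ a hww b with e | e | e | e
      · exact absurd (by linear_combination e) h4
      · exact absurd (by linear_combination e) h6
      · exact absurd (by linear_combination e) h2
      · exact absurd (by linear_combination e) h8
    · left; rw [if_pos a, if_neg b]; norm_num
    · left; rw [if_neg a, if_pos b]; norm_num
    · right; rw [if_neg a, if_neg b]; norm_num
  -- Up to exchanging `w` and `w'` these cases cover every edge.
  have half : ∀ w w', G.Adj w w' → (G.Adj u w ∨ (G.Adj v w ∧ ¬ G.Adj u w') ∨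
      (¬ G.Adj u w ∧ ¬ G.Adj v w ∧ ¬ G.Adj u w' ∧ ¬ G.Adj v w')) →
      φ w' = φ w + 1 ∨ φ w = φ w' + 1 := by
    rintro w w' hww (hw | ⟨hw, hw'⟩ | ⟨hw1, hw2, hw3, hw4⟩)
    · have huw' : ¬ G.Adj u w' := fun hw' => h.not_triangle hg hw hww hw'
      by_cases hvw' : G.Adj v w'
      · exact edge_uv w w' hw hvw' hww
      · obtain ⟨i, rfl⟩ := ((hcov w').resolve_left huw').resolve_left hvw'
        obtain rfl := edge_uc w i hw hvw' hww
        right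
        rw [φu w hw, φc _ huw' hvw', hψc, if_pos hww]
        norm_num
    · have hvw' : ¬ G.Adj v w' := fun hw' => h.not_triangle hg hw hww hw'
      obtain ⟨i, rfl⟩ := ((hcov w').resolve_left hw').resolve_left hvw'
      obtain rfl := edge_vc w i hw hw' hww
      left
      rw [φv w hw, φc _ hw' hvw', hψc, if_pos hww]
      norm_num
    · obtain ⟨i, rfl⟩ := ((hcov w).resolve_left hw1).resolve_left hw2
      obtain ⟨j, rfl⟩ := ((hcov w').resolve_left hw3).resolve_left hw4
      rw [φc _ hw1 hw2, φc _ hw3 hw4, hψc, hψc]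
      refine (h.eq_of_adj hww).imp id fun e => ?_
      rw [e, sub_add_cancel]
  refine ⟨φ, fun w w' hww => ?_, fun i => ?_, fun w w0 w1 w2 w3 => ?_, ?_, ?_⟩
  · have := half w w' hww
    have := half w' w hww.symm
    clear_value φ
    tauto
  · by_cases hui : G.Adj u (c i)
    · rw [φu _ hui]
      rcases (hu i).1 hui with rfl | rfl
      · rw [if_pos (by simpa using (h.adj (-1)).symm)]
      · rw [if_neg]
        intro hadj
        rcases h.eq_of_adj hadj with e | e
        · exact h4 (by linear_combination -e)
        · exact h2 (by linear_combination -e)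
    · by_cases hvi : G.Adj v (c i)
      · rw [φv _ hvi]
        rcases (hv i).1 hvi with rfl | rfl
        · rw [if_neg]
          intro hadj
          rcases h.eq_of_adj hadj with e | e
          · exact h2 (by linear_combination e)
          · exact h4 (by linear_combination e)
        · have := h.adj 3
          rw [show (3 : ZMod g) + 1 = 4 by norm_num] at this
          rw [if_pos this]
      · rw [φc _ hui hvi, hψc]
  · by_cases huw : G.Adj u w
    · rw [φu w huw] at w0 w2
      by_cases a : G.Adj w (c (-1))
      · exact absurd (if_pos a) w0
      · exact absurd (if_neg a) w2
    · by_cases hvw : G.Adj v w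
      · rw [φv w hvw] at w1 w3
        by_cases a : G.Adj w (c 4)
        · exact absurd (if_pos a) w3
        · exact absurd (if_neg a) w1
      · rw [φc w huw hvw]
        exact (hψ w (((hcov w).resolve_left huw).resolve_left hvw)).symm
  · rw [φv u huv.symm, if_neg]
    rw [hu]
    rintro (e | e)
    · exact h4 e
    · exact h2 (by linear_combination e)
  · rw [φu v huv, if_neg]
    rw [hv]
    rintro (e | e)
    · exact h2 (by linear_combination -e)
    · exact h4 (by linear_combination -e)

end IsShortestOddCycle

end Folding

/-! ### Inequalities for the fibre sizes -/

section Arithmetic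

/-- `h0` with `q (N - q) ≤ 1`, `N = a + b + c + d`, keeps `α` within `1 / q` of 1. But `h1` gives
`(q - a - b) α ≤ 1 + c` with `q - a - b > c + d - 1`, which is too small once `d ≥ 3`. -/
theorem outer_fibre_le_two {a b c d q α β γ : ℝ} (ha : 1 ≤ a) (hd : 1 ≤ d)
    (hq : a + b + c + d - 1 < q) (hq' : q * (a + b + c + d - q) ≤ 1) (hb : 1 ≤ b) (hc : 1 ≤ c)
    (hα : α ≤ 1) (hβ : β ≤ 1) (hγ : γ ≤ 1)
    (h0 : q ≤ a * α + b + c + d * β) (h1 : q * α ≤ γ + (a + b) * α + c) : d < 3 := by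
  have hu : 1 - α ≤ a + b + c + d - q := by nlinarith
  have hqu : q * (1 - α) ≤ 1 := by nlinarith
  nlinarith

theorem outer_fibre_ne_two {a b c q α β γ γ' γ'' : ℝ} (ha : a = 1 ∨ a = 2) (hb : 1 ≤ b)
    (hc : 1 ≤ c) (hN : 6 ≤ a + b + c + 2)
    (hq : a + b + c + 2 - 1 < q) (hq' : q * (a + b + c + 2 - q) ≤ 1)
    (hα : α ≤ 1) (hβ : β ≤ 1) (hγ : γ ≤ 1) (hγ'' : γ'' ≤ 1)
    (h0 : q ≤ a * α + b + c + 2 * β) (h1 : q * α ≤ γ + (a + b) * α + c)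
    (h2 : q * γ ≤ γ' + (1 + a) * γ + b * α) (h3 : q * γ' ≤ γ'' + 2 * γ' + a * γ) : False := by
  have hu : a * (1 - α) ≤ a + b + c + 2 - q := by nlinarith
  have hqu : q * (a * (1 - α)) ≤ 1 := by nlinarith
  rcases ha with rfl | rfl
  -- For `a = 1` the class of `α` is no obstruction by itself; it forces `γ` near 1, and then `h2`
  -- gives `c ≤ 1/5 + 2/3 < 1`.
  · have hγ1 : q - (b + c + 2) ≤ γ := by nlinarith
    have h4 : q - 1 ≤ q * γ := by nlinarith
    have h5 : c ≤ 3 + b + c - q + γ' := by nlinarith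
    have h6 : q * γ' ≤ 2 + 2 * γ' := by linarith
    have h7 : γ' ≤ 2 / 3 := by nlinarith
    have h8 : (3 + b + c - q) ≤ 1 / 5 := by nlinarith
    linarith
  · nlinarith

/-- A lower bound for the defect of the outer edge class when both outer fibres are singletons. -/
theorem defect_lower_bound {a b q α γ γ' : ℝ} (ha : 2 ≤ a) (hb : 2 ≤ b)
    (hq : a + b + 1 < q) (hqN : q ≤ a + b + 2) (hq' : q * (a + b + 2 - q) ≤ 1)
    (hα : α ≤ 1) (h1 : q * α ≤ γ + (1 + a) * α + b) (h2 : q * γ ≤ γ' + 2 * γ + a * α) :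
    b - 1 - γ' + (a + b + 2 - q) ≤ (1 - α) * (b * (q - 1)) := by
  obtain ⟨e, rfl⟩ : ∃ e, q = a + b + 2 - e := ⟨a + b + 2 - q, by ring⟩
  obtain ⟨u, rfl⟩ : ∃ u, α = 1 - u := ⟨1 - α, by ring⟩
  have he : e < 1 := by linarith
  have hu : 0 ≤ u := by linarith
  have hee : (a + b - e) * e ≤ 1 - 2 * e := by nlinarith
  have he0 : 0 ≤ a + b - e := by linarith
  -- With `e = a + b + 2 - q` and `u = 1 - α`, `h1` bounds `1 - γ` above and `h2` bounds it below.
  -- Eliminating `γ` gives the claim up to the nonnegative term `h5`.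
  have hc : 1 - γ - e ≤ (b + 1 - e) * u := by nlinarith
  have h3 : b - e + a * u - γ' ≤ (a + b - e) * (1 - γ) := by nlinarith
  have h4 := mul_le_mul_of_nonneg_left hc he0
  have h5 : 0 ≤ u * (e * (1 + (a + b - e))) :=
    mul_nonneg hu (mul_nonneg (by linarith) (by linarith))
  nlinarith

/-- Serves the case `a = b = 2`, where any bound below `1/3` would do. -/
theorem second_weight_le {q α γ γ' γ'' : ℝ} (hq : 5.8 < q) (hα : α ≤ 1)
    (h2 : q * γ ≤ γ' + 2 * γ + 2 * α) (h3 : q * γ' ≤ γ'' + 2 * γ' + γ)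
    (h4 : q * γ'' ≤ 2 + 2 * γ'') : γ' ≤ 0.299 := by
  by_contra! hc
  have g2 : γ'' ≤ 0.5264 := by
    by_contra! h
    nlinarith
  have e1 : 5.8 * γ' ≤ q * γ' := mul_le_mul_of_nonneg_right hq.le (by linarith)
  have g0 : 0 ≤ γ := by linarith
  have e2 : 5.8 * γ ≤ q * γ := mul_le_mul_of_nonneg_right hq.le g0
  linarith

/-- The two defects `1 - α` and `1 - β` add up to at most `a + b + 2 - q ≤ 1 / q`, whereas
`defect_lower_bound`, applied from both sides, makes them larger. The margin is thinnest for `a = b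
= 2`, which needs the sharper weights. -/
theorem inner_fibre_contradiction {a b q α β γ δ γ' δ' γ'' δ'' : ℝ} (ha : 2 ≤ a) (hb : 2 ≤ b)
    (hab : (a = 2 ∧ b = 2) ∨ 6 * (a + b) ≤ 5 * (a * b) ∧ 5 ≤ a + b)
    (hq : a + b + 1 < q) (hq' : q * (a + b + 2 - q) ≤ 1)
    (hα : α ≤ 1) (hβ : β ≤ 1) (hγ : γ ≤ 1) (hδ : δ ≤ 1)
    (h0 : q ≤ α + a + b + β)
    (h1 : q * α ≤ γ + (1 + a) * α + b) (h2 : q * γ ≤ γ' + 2 * γ + a * α)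
    (h3 : q * γ' ≤ γ'' + 2 * γ' + γ) (h4 : q * γ'' ≤ 2 + 2 * γ'')
    (k1 : q * β ≤ δ + (1 + b) * β + a) (k2 : q * δ ≤ δ' + 2 * δ + b * β)
    (k3 : q * δ' ≤ δ'' + 2 * δ' + δ) (k4 : q * δ'' ≤ 2 + 2 * δ'') : False := by
  have hqN : q ≤ a + b + 2 := by linarith
  have hu := defect_lower_bound ha hb hq hqN hq' hα h1 h2
  have hv := defect_lower_bound hb ha (by linarith) (by linarith) (by linarith) hβ k1 k2
  have huv : (1 - α) + (1 - β) ≤ a + b + 2 - q := by linarith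
  have hab0 : 0 ≤ a * b * (q - 1) := by
    have : 0 ≤ q - 1 := by linarith
    positivity
  have hsum : a * (b - 1 - γ' + (a + b + 2 - q)) + b * (a - 1 - δ' + (a + b + 2 - q))
      ≤ (a + b + 2 - q) * (a * b * (q - 1)) := by
    have e1 := mul_le_mul_of_nonneg_left hu (by linarith : 0 ≤ a)
    have e2 := mul_le_mul_of_nonneg_left hv (by linarith : 0 ≤ b)
    have e3 := mul_le_mul_of_nonneg_right huv hab0
    linarith
  rcases hab with ⟨rfl, rfl⟩ | ⟨hab, h5⟩
  · have hq5 : 5.8 < q := by nlinarith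
    have g1 := second_weight_le hq5 hα h2 h3 h4
    have d1 := second_weight_le hq5 hβ k2 k3 k4
    have hq6 : q ≤ 6 := by linarith
    have e1 : 0 ≤ (6 - q) * (6 - q) := mul_self_nonneg _
    linarith
  · have hq6 : 6 < q := by linarith
    have g2 : γ'' ≤ 0.5 := by nlinarith
    have d2 : δ'' ≤ 0.5 := by nlinarith
    have g1 : γ' ≤ 0.375 := by nlinarith
    have d1 : δ' ≤ 0.375 := by nlinarith
    have g0 : q * γ' ≤ 2.25 := by linarith
    have d0 : q * δ' ≤ 2.25 := by linarith
    have hF : 0 ≤ a * b * (q - 1) - (a + b) := by nlinarith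
    have e1 := mul_le_mul_of_nonneg_right hq' hF
    have e2 := mul_le_mul_of_nonneg_left hsum (by linarith : 0 ≤ q)
    have e3 := mul_le_mul_of_nonneg_left g0 (by linarith : 0 ≤ a)
    have e4 := mul_le_mul_of_nonneg_left d0 (by linarith : 0 ≤ b)
    have e5 := mul_le_mul_of_nonneg_right hab (by linarith : 0 ≤ q + 1.25)
    have e6 : 0 < a * b * (q - 0.25) := mul_pos (by positivity) (by linarith)
    linarith

/-- The weights `α, β, γ, …` are the largest normalised edge sums on the successive edge classes of
a blow-up of a cycle with fibres of sizes `…, 1, a, b, c, d, 1, …`. -/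
theorem three_fibres_eq_one {a b c d : ℕ} {q α β γ δ γ' δ' γ'' δ'' : ℝ} (ha : 1 ≤ a) (hb : 1 ≤ b)
    (hc : 1 ≤ c) (hd : 1 ≤ d) (hq : (a + b + c + d : ℝ) - 1 < q)
    (hq' : q * ((a + b + c + d : ℝ) - q) ≤ 1)
    (hα : α ≤ 1) (hβ : β ≤ 1) (hγ : γ ≤ 1) (hδ : δ ≤ 1) (hγ'' : γ'' ≤ 1) (hδ'' : δ'' ≤ 1)
    (h0 : q ≤ a * α + b + c + d * β)
    (h1 : q * α ≤ γ + (a + b) * α + c) (h2 : q * γ ≤ γ' + (1 + a) * γ + b * α)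
    (h3 : q * γ' ≤ γ'' + 2 * γ' + a * γ) (h4 : q * γ'' ≤ d + 2 * γ'' + 1)
    (k1 : q * β ≤ δ + (d + c) * β + b) (k2 : q * δ ≤ δ' + (1 + d) * δ + c * β)
    (k3 : q * δ' ≤ δ'' + 2 * δ' + d * δ) (k4 : q * δ'' ≤ a + 2 * δ'' + 1) :
    (b = 1 ∧ c = 1 ∧ d = 1) ∨ (a = 1 ∧ c = 1 ∧ d = 1) ∨ (a = 1 ∧ b = 1 ∧ d = 1) ∨
      (a = 1 ∧ b = 1 ∧ c = 1) := by
  have ha' : (1 : ℝ) ≤ a := by exact_mod_cast ha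
  have hb' : (1 : ℝ) ≤ b := by exact_mod_cast hb
  have hc' : (1 : ℝ) ≤ c := by exact_mod_cast hc
  have hd' : (1 : ℝ) ≤ d := by exact_mod_cast hd
  have hd3 : d < 3 := by
    exact_mod_cast outer_fibre_le_two ha' hd' hq hq' hb' hc' hα hβ hγ h0 h1
  have ha3 : a < 3 := by
    exact_mod_cast outer_fibre_le_two hd' ha' (b := c) (c := b) (by linarith) (by linarith) hc' hb'
      hβ hα hδ (by linarith) k1
  -- A sum of at most 5 already leaves room for only one size above 1.
  by_cases hN : a + b + c + d ≤ 5
  · omega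
  have hN' : 6 ≤ a + b + c + d := by omega
  have hN6 : (6 : ℝ) ≤ a + b + c + d := by exact_mod_cast hN'
  have hd1 : d = 1 := by
    by_contra hne
    obtain rfl : d = 2 := by omega
    push_cast at *
    have haa : (a : ℝ) = 1 ∨ (a : ℝ) = 2 := by
      have : a = 1 ∨ a = 2 := by omega
      exact_mod_cast this
    exact outer_fibre_ne_two haa hb' hc' hN6 hq hq' hα hβ hγ hγ'' h0 h1 h2 h3
  have ha1 : a = 1 := by
    by_contra hne
    obtain rfl : a = 2 := by omega
    subst hd1
    push_cast at *
    exact outer_fibre_ne_two (Or.inl rfl) hc' hb' (by linarith) (by linarith) (by linarith) hβ hα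
      hδ hδ'' (by linarith) k1 k2 k3
  subst hd1 ha1
  by_contra hne
  have hb2 : 2 ≤ b := by omega
  have hc2 : 2 ≤ c := by omega
  have hcase : (b = 2 ∧ c = 2) ∨ 6 * (b + c) ≤ 5 * (b * c) ∧ 5 ≤ b + c := by
    by_cases h : b + c ≤ 4
    · left; omega
    · right
      refine ⟨?_, by omega⟩
      obtain ⟨b, rfl⟩ := Nat.exists_eq_add_of_le hb2
      obtain ⟨c, rfl⟩ := Nat.exists_eq_add_of_le hc2
      nlinarith [Nat.zero_le (b * c)]
  push_cast at *
  exact inner_fibre_contradiction (a := b) (b := c) (by exact_mod_cast hb2) (by exact_mod_cast hc2)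
    (by exact_mod_cast hcase) (q := q) (by linarith) (by linarith) hα hβ hγ hδ (by linarith)
    (by linarith) (γ' := γ') (by linarith) (γ'' := γ'') (by linarith) (by linarith) (by linarith)
    (δ' := δ') (by linarith) (δ'' := δ'') (by linarith) (by linarith)

end Arithmetic

/-! ### Edge classes of a folded graph -/

section FoldWeights

variable {V : Type*} [Fintype V] {G : SimpleGraph V} {g : ℕ}

open Classical in
/-- The size of a fibre of a map to `ZMod g`. -/
noncomputable def fibreCard (φ : V → ZMod g) (i : ZMod g) : ℕ := (Finset.univ.filter (φ · = i)).card

open Classical in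
/-- The largest weights on the edge classes of a graph folded onto a cycle satisfy the edge
inequalities of the corresponding blow-up. -/
theorem exists_class_weights {φ : V → ZMod g}
    (hφ : ∀ w w', G.Adj w w' → φ w' = φ w + 1 ∨ φ w = φ w' + 1) {f : V → V → ℝ} {q : ℝ}
    (h0 : ∀ a b, 0 ≤ f a b) (h1 : ∀ a b, G.Adj a b → f a b ≤ 1) (hsymm : ∀ a b, f a b = f b a)
    (hf : ∀ a b, q * f a b ≤ ∑ w with G.Adj a w, f a w + ∑ w with G.Adj b w, f b w) :
    ∃ M : ZMod g → ℝ, (∀ i, 0 ≤ M i) ∧ (∀ i, M i ≤ 1) ∧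
      (∀ a b, G.Adj a b → φ b = φ a + 1 → f a b ≤ M (φ a)) ∧
      ∀ i, q * M i ≤ fibreCard φ (i - 1) * M (i - 1) +
        (fibreCard φ i + fibreCard φ (i + 1)) * M i + fibreCard φ (i + 2) * M (i + 1) := by
  have hM : ∀ i, ∃ m : ℝ, (∀ a b, G.Adj a b → φ a = i → φ b = i + 1 → f a b ≤ m) ∧
      -- An empty class gets weight 0, for which its inequality is trivial.
      (m = 0 ∨ ∃ a b, G.Adj a b ∧ φ a = i ∧ φ b = i + 1 ∧ f a b = m) := by
    intro i
    let S : Finset (V × V) :=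
      Finset.univ.filter fun p => G.Adj p.1 p.2 ∧ φ p.1 = i ∧ φ p.2 = i + 1
    by_cases hS : S.Nonempty
    · obtain ⟨p, hp, hmax⟩ := S.exists_max_image (fun p => f p.1 p.2) hS
      have hp' : G.Adj p.1 p.2 ∧ φ p.1 = i ∧ φ p.2 = i + 1 := by simpa [S] using hp
      exact ⟨f p.1 p.2, fun a b hab ha hb => hmax (a, b) (by simp [S, hab, ha, hb]),
        Or.inr ⟨p.1, p.2, hp'.1, hp'.2.1, hp'.2.2, rfl⟩⟩
    · refine ⟨0, fun a b hab ha hb => ?_, Or.inl rfl⟩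
      exact absurd ⟨(a, b), by simp [S, hab, ha, hb]⟩ hS
  choose M hM1 hM2 using hM
  have hM0 : ∀ i, 0 ≤ M i := fun i => by
    rcases hM2 i with h | ⟨a, b, -, -, -, h⟩
    · exact h.ge
    · exact h ▸ h0 a b
  have hsum : ∀ a, ∑ w with G.Adj a w, f a w ≤
      fibreCard φ (φ a - 1) * M (φ a - 1) + fibreCard φ (φ a + 1) * M (φ a) := by
    intro a
    have hc : ∀ (i : ZMod g) (m : ℝ), (fibreCard φ i : ℝ) * m = ∑ w, if φ w = i then m else 0 := by
      intro i m
      rw [← Finset.sum_filter, Finset.sum_const, nsmul_eq_mul, fibreCard]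
    rw [hc, hc, ← Finset.sum_add_distrib, Finset.sum_filter]
    refine Finset.sum_le_sum fun w _ => ?_
    have n1 : 0 ≤ if φ w = φ a - 1 then M (φ a - 1) else 0 := by
      split_ifs <;> simp [hM0]
    have n2 : 0 ≤ if φ w = φ a + 1 then M (φ a) else 0 := by
      split_ifs <;> simp [hM0]
    by_cases haw : G.Adj a w
    · rw [if_pos haw]
      rcases hφ a w haw with h | h
      · have := hM1 _ a w haw rfl h
        rw [if_pos h]
        linarith
      · have h' : φ w = φ a - 1 := eq_sub_of_add_eq h.symm
        have := hM1 (φ a - 1) w a haw.symm h' (by rw [sub_add_cancel])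
        rw [if_pos h', hsymm]
        linarith
    · rw [if_neg haw]
      linarith
  refine ⟨M, hM0, fun i => ?_, fun a b hab h => hM1 _ a b hab rfl h, fun i => ?_⟩
  · rcases hM2 i with h | ⟨a, b, hab, -, -, h⟩
    · rw [h]; exact zero_le_one
    · exact h ▸ h1 a b hab
  · rcases hM2 i with h | ⟨a, b, hab, ha, hb, h⟩
    · rw [h]
      have := hM0 (i - 1)
      have := hM0 (i + 1)
      simp only [mul_zero, add_zero]
      positivity
    · have e1 := hf a b
      have e2 := hsum a
      have e3 := hsum b
      rw [ha] at e2
      rw [hb, add_sub_cancel_right, add_assoc, one_add_one_eq_two] at e3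
      rw [h] at e1
      linarith

theorem sum_fibreCard [NeZero g] (φ : V → ZMod g) : ∑ i, fibreCard φ i = Fintype.card V := by
  classical
  rw [← Finset.card_univ, Finset.card_eq_sum_card_fiberwise (f := φ) (t := Finset.univ) (by simp)]
  exact Finset.sum_congr rfl fun i _ => by unfold fibreCard; congr

theorem fibreCard_sum_four {k : ℕ} (hk : 2 ≤ k) {φ : V → ZMod (2 * k + 3)}
    (hφ : ∀ i, i ≠ 0 → i ≠ 1 → i ≠ 2 → i ≠ 3 → fibreCard φ i = 1) :
    fibreCard φ 0 + fibreCard φ 1 + fibreCard φ 2 + fibreCard φ 3 + (2 * k + 3) =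
      Fintype.card V + 4 := by
  rw [← sum_fibreCard φ]
  have h : ∀ m l : ℕ, m < 7 → l < 7 → m ≠ l → (m : ZMod (2 * k + 3)) ≠ l := by
    intro m l hm hl hml h
    rw [ZMod.natCast_eq_natCast_iff', Nat.mod_eq_of_lt (by omega), Nat.mod_eq_of_lt (by omega)] at h
    exact hml h
  have h01 := h 0 1 (by omega) (by omega) (by omega)
  have h02 := h 0 2 (by omega) (by omega) (by omega)
  have h03 := h 0 3 (by omega) (by omega) (by omega)
  have h12 := h 1 2 (by omega) (by omega) (by omega)
  have h13 := h 1 3 (by omega) (by omega) (by omega)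
  have h23 := h 2 3 (by omega) (by omega) (by omega)
  push_cast at h01 h02 h03 h12 h13 h23
  set S : Finset (ZMod (2 * k + 3)) := {0, 1, 2, 3} with hS
  have hcard : S.card = 4 := by
    rw [hS, Finset.card_insert_of_notMem (by simp [h01, h02, h03]),
      Finset.card_insert_of_notMem (by simp [h12, h13]), Finset.card_pair h23]
  have h4 : ∑ i ∈ S, fibreCard φ i =
      fibreCard φ 0 + fibreCard φ 1 + fibreCard φ 2 + fibreCard φ 3 := by
    rw [hS, Finset.sum_insert (by simp [h01, h02, h03]), Finset.sum_insert (by simp [h12, h13]),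
      Finset.sum_pair h23]
    ring
  have h5 : ∑ i ∈ Sᶜ, fibreCard φ i = 2 * k + 3 - 4 := by
    rw [Finset.sum_congr rfl (g := fun _ => 1), Finset.sum_const, Finset.card_compl, hcard, ZMod.card]
    · simp
    · intro i hi
      simp only [hS, Finset.mem_compl, Finset.mem_insert, Finset.mem_singleton, not_or] at hi
      exact hφ i hi.1 hi.2.1 hi.2.2.1 hi.2.2.2
  rw [← Finset.sum_add_sum_compl S, h4, h5]
  omega

theorem exists_fibre_of_bounds {k : ℕ} (hk : 2 ≤ k) {φ : V → ZMod (2 * k + 3)}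
    (hpos : ∀ i, 1 ≤ fibreCard φ i)
    (hone : ∀ i, i ≠ 0 → i ≠ 1 → i ≠ 2 → i ≠ 3 → fibreCard φ i = 1) {q : ℝ} {m : ℕ}
    (hm : m + (2 * k + 2) = Fintype.card V) (hq : (m : ℝ) + 2 < q) (hq' : q * ((m + 3) - q) ≤ 1)
    {M : ZMod (2 * k + 3) → ℝ} (hM1 : ∀ i, M i ≤ 1) (hM : M 1 = 1)
    (hineq : ∀ i, q * M i ≤ fibreCard φ (i - 1) * M (i - 1) +
        (fibreCard φ i + fibreCard φ (i + 1)) * M i + fibreCard φ (i + 2) * M (i + 1)) :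
    ∃ i₀, fibreCard φ i₀ = m ∧ ∀ i, i ≠ i₀ → fibreCard φ i = 1 := by
  have hsum := fibreCard_sum_four hk hone
  have hne : ∀ m l : ℕ, m < 7 → l < 7 → m ≠ l → (m : ZMod (2 * k + 3)) - l ≠ 0 := by
    intro m l hm hl hml h
    rw [sub_eq_zero, ZMod.natCast_eq_natCast_iff', Nat.mod_eq_of_lt (by omega),
      Nat.mod_eq_of_lt (by omega)] at h
    exact hml h
  have n1 : (1 : ZMod (2 * k + 3)) ≠ 0 := by simpa using hne 1 0 (by omega) (by omega) (by omega)
  have n2 : (2 : ZMod (2 * k + 3)) ≠ 0 := by simpa using hne 2 0 (by omega) (by omega) (by omega)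
  have n3 : (3 : ZMod (2 * k + 3)) ≠ 0 := by simpa using hne 3 0 (by omega) (by omega) (by omega)
  have n4 : (4 : ZMod (2 * k + 3)) ≠ 0 := by simpa using hne 4 0 (by omega) (by omega) (by omega)
  have n5 : (5 : ZMod (2 * k + 3)) ≠ 0 := by simpa using hne 5 0 (by omega) (by omega) (by omega)
  have n6 : (6 : ZMod (2 * k + 3)) ≠ 0 := by simpa using hne 6 0 (by omega) (by omega) (by omega)
  have f4 : fibreCard φ 4 = 1 := hone _ n4 (fun h => n3 (by linear_combination h))
    (fun h => n2 (by linear_combination h)) (fun h => n1 (by linear_combination h))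
  have f5 : fibreCard φ 5 = 1 := hone _ n5 (fun h => n4 (by linear_combination h))
    (fun h => n3 (by linear_combination h)) (fun h => n2 (by linear_combination h))
  have f6 : fibreCard φ 6 = 1 := hone _ n6 (fun h => n5 (by linear_combination h))
    (fun h => n4 (by linear_combination h)) (fun h => n3 (by linear_combination h))
  -- On a cycle of length 7 position 7 is position 0, whose fibre may be large; otherwise its fibre
  -- is a singleton. The same happens with -4 and 3 below.
  have f7 : fibreCard φ 7 ≤ fibreCard φ 0 := by
    by_cases n7 : (7 : ZMod (2 * k + 3)) = 0
    · rw [n7]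
    · rw [hone _ n7 (fun h => n6 (by linear_combination h))
        (fun h => n5 (by linear_combination h)) (fun h => n4 (by linear_combination h))]
      exact hpos 0
  have g1 : fibreCard φ (-1) = 1 := hone _ (fun h => n1 (by linear_combination -h))
    (fun h => n2 (by linear_combination -h)) (fun h => n3 (by linear_combination -h))
    (fun h => n4 (by linear_combination -h))
  have g2 : fibreCard φ (-2) = 1 := hone _ (fun h => n2 (by linear_combination -h))
    (fun h => n3 (by linear_combination -h)) (fun h => n4 (by linear_combination -h))
    (fun h => n5 (by linear_combination -h))
  have g3 : fibreCard φ (-3) = 1 := hone _ (fun h => n3 (by linear_combination -h))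
    (fun h => n4 (by linear_combination -h)) (fun h => n5 (by linear_combination -h))
    (fun h => n6 (by linear_combination -h))
  have g4 : fibreCard φ (-4) ≤ fibreCard φ 3 := by
    by_cases n7 : (7 : ZMod (2 * k + 3)) = 0
    · rw [show (-4 : ZMod (2 * k + 3)) = 3 by linear_combination -n7]
    · rw [hone _ (fun h => n4 (by linear_combination -h)) (fun h => n5 (by linear_combination -h))
        (fun h => n6 (by linear_combination -h)) (fun h => n7 (by linear_combination -h))]
      exact hpos 3
  have i1 := hineq 1
  have i0 := hineq 0
  have j1 := hineq (-1)
  have j2 := hineq (-2)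
  have j3 := hineq (-3)
  have i2 := hineq 2
  have i3 := hineq 3
  have i4 := hineq 4
  have i5 := hineq 5
  norm_num at i0 i1 i2 i3 i4 i5 j1 j2 j3
  simp only [f4, f5, f6, g1, g2, g3, hM, Nat.cast_one, one_mul, mul_one]
    at i0 i1 i2 i3 i4 i5 j1 j2 j3
  have f7' : (fibreCard φ 7 : ℝ) * M 6 ≤ fibreCard φ 0 :=
    (mul_le_of_le_one_right (by positivity) (hM1 6)).trans (by exact_mod_cast f7)
  have g4' : (fibreCard φ (-4) : ℝ) * M (-4) ≤ fibreCard φ 3 :=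
    (mul_le_of_le_one_right (by positivity) (hM1 (-4))).trans (by exact_mod_cast g4)
  have hNat : fibreCard φ 0 + fibreCard φ 1 + fibreCard φ 2 + fibreCard φ 3 = m + 3 := by omega
  have hN : (fibreCard φ 0 + fibreCard φ 1 + fibreCard φ 2 + fibreCard φ 3 : ℝ) = m + 3 := by
    exact_mod_cast hNat
  have key := three_fibres_eq_one (hpos 0) (hpos 1) (hpos 2) (hpos 3) (q := q) (α := M 0)
    (β := M 2) (γ := M (-1)) (δ := M 3) (γ' := M (-2)) (δ' := M 4) (γ'' := M (-3)) (δ'' := M 5)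
    (by rw [hN]; linarith) (by rw [hN]; exact hq') (hM1 _) (hM1 _) (hM1 _) (hM1 _) (hM1 _) (hM1 _)
    (by linarith) (by linarith) (by linarith) (by linarith) (by linarith [hM1 (-2)])
    (by linarith) (by linarith) (by linarith) (by linarith [hM1 4])
  rcases key with h | h | h | h
  · refine ⟨0, by omega, fun i hi => ?_⟩
    by_cases e1 : i = 1
    · rw [e1, h.1]
    by_cases e2 : i = 2
    · rw [e2, h.2.1]
    by_cases e3 : i = 3
    · rw [e3, h.2.2]
    exact hone i hi e1 e2 e3
  · refine ⟨1, by omega, fun i hi => ?_⟩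
    by_cases e0 : i = 0
    · rw [e0, h.1]
    by_cases e2 : i = 2
    · rw [e2, h.2.1]
    by_cases e3 : i = 3
    · rw [e3, h.2.2]
    exact hone i e0 hi e2 e3
  · refine ⟨2, by omega, fun i hi => ?_⟩
    by_cases e0 : i = 0
    · rw [e0, h.1]
    by_cases e1 : i = 1
    · rw [e1, h.2.1]
    by_cases e3 : i = 3
    · rw [e3, h.2.2]
    exact hone i e0 e1 hi e3
  · refine ⟨3, by omega, fun i hi => ?_⟩
    by_cases e0 : i = 0
    · rw [e0, h.1]
    by_cases e1 : i = 1
    · rw [e1, h.2.1]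
    by_cases e2 : i = 2
    · rw [e2, h.2.2]
    exact hone i e0 e1 e2 hi

theorem exists_equiv_extremal {k m : ℕ} {φ : V → ZMod (2 * k + 3)}
    (hφ : ∀ w w', G.Adj w w' → φ w' = φ w + 1 ∨ φ w = φ w' + 1) {i₀ : ZMod (2 * k + 3)}
    (h0 : fibreCard φ i₀ = m) (h1 : ∀ i, i ≠ i₀ → fibreCard φ i = 1) :
    ∃ e : V ≃ Σ i : Fin (2 * k + 3), Fin (headVector (2 * k + 3) m i), ∀ u v, G.Adj u v →
      (blowUp (SimpleGraph.cycleGraph (2 * k + 3)) (headVector (2 * k + 3) m)).Adj (e u) (e v) := by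
  classical
  -- Rotates the large fibre to position 0; `ZMod (2 * k + 3)` unfolds to `Fin (2 * k + 3)`.
  let ψ : V → Fin (2 * k + 3) := fun w => (φ w - i₀ : ZMod (2 * k + 3))
  have hfib : ∀ i : ZMod (2 * k + 3), Fintype.card {w // φ w - i₀ = i} = fibreCard φ (i + i₀) := by
    intro i
    rw [Fintype.card_subtype, fibreCard]
    congr 1
    ext w
    simp only [Finset.mem_filter, Finset.mem_univ, true_and]
    exact sub_eq_iff_eq_add
  have hcard : ∀ i : Fin (2 * k + 3), Fintype.card {w // ψ w = i} = headVector (2 * k + 3) m i := by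
    intro i
    refine (Fintype.card_congr (Equiv.refl _)).trans ((hfib i).trans ?_)
    rw [headVector]
    split_ifs with hi
    · obtain rfl : i = 0 := Fin.ext hi
      rw [← h0]
      congr 1
      exact zero_add i₀
    · exact h1 _ fun h => hi (congrArg Fin.val (add_eq_right.1 h))
  refine ⟨(Equiv.sigmaFiberEquiv ψ).symm.trans
    (Equiv.sigmaCongrRight fun i => Fintype.equivFinOfCardEq (hcard i)), fun u v huv => ?_⟩
  refine (cycleGraph_adj_zmod k (φ u - i₀) (φ v - i₀)).2 ?_
  rcases hφ u v huv with h | h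
  · right; rw [h]; ring
  · left; rw [h]; ring

end FoldWeights

/-! ### From the eigenvector to the extremal graph -/

section Main

variable {V : Type*} [Fintype V] {G : SimpleGraph V}

open Classical in
/-- Normalised edge sums of an eigenvector of the `Q`-index. -/
theorem exists_edge_weights [Nonempty V] (hq : 0 < qIndex G) :
    ∃ f : V → V → ℝ, (∀ a b, 0 ≤ f a b) ∧ (∀ a b, G.Adj a b → f a b ≤ 1) ∧
      (∀ a b, f a b = f b a) ∧ (∃ u v, G.Adj u v ∧ f u v = 1) ∧
      ∀ a b, qIndex G * f a b ≤ ∑ w with G.Adj a w, f a w + ∑ w with G.Adj b w, f b w := by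
  obtain ⟨x, hx0, hx⟩ := exists_eigenvector_qIndex G
  let S : Finset (V × V) := Finset.univ.filter fun p => G.Adj p.1 p.2 ∧ x p.1 + x p.2 ≠ 0
  have hS : S.Nonempty := by
    by_contra hS
    refine hx0 (funext fun u => ?_)
    have h := hx u
    rw [Finset.sum_eq_zero] at h
    · simpa [hq.ne'] using h.symm
    · intro w hw
      by_contra hne
      exact hS ⟨(u, w), by simpa [S, hne] using hw⟩
  obtain ⟨⟨u, v⟩, huv, hmax⟩ := S.exists_max_image (fun p => |x p.1 + x p.2|) hS
  obtain ⟨huv, hne⟩ : G.Adj u v ∧ x u + x v ≠ 0 := by simpa [S] using huv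
  have hpos : 0 < |x u + x v| := abs_pos.2 hne
  refine ⟨fun a b => |x a + x b| / |x u + x v|, fun a b => by positivity, fun a b hab => ?_,
    fun a b => congrArg (|·| / |x u + x v|) (add_comm _ _), ⟨u, v, huv, div_self hpos.ne'⟩,
    fun a b => ?_⟩
  · rw [div_le_one hpos]
    by_cases h0 : x a + x b = 0
    · rw [h0, abs_zero]; exact hpos.le
    · exact hmax (a, b) (by simp [S, hab, h0])
  · rw [← Finset.sum_div, ← Finset.sum_div, ← add_div, ← mul_div_assoc]
    exact div_le_div_of_nonneg_right (qIndex_mul_abs_add_le hq.le hx a b) hpos.le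

/-- A graph of odd girth at least `2 * k + 3` whose `Q`-index is not smaller than that of the
extremal graph is a spanning subgraph of the extremal graph. -/
theorem exists_equiv_extremal_of_qIndex_le {k m : ℕ} (hk : 2 ≤ k) (hm : 1 ≤ m)
    (hcard : m + (2 * k + 2) = Fintype.card V)
    (hfree : ∀ j : ℕ, 1 ≤ j → j ≤ k → (SimpleGraph.cycleGraph (2 * j + 1)).Free G)
    (hbip : ¬ G.IsBipartite)
    (hq : qIndex (blowUp (SimpleGraph.cycleGraph (2 * k + 3)) (headVector (2 * k + 3) m)) ≤
      qIndex G) :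
    ∃ e : V ≃ Σ i : Fin (2 * k + 3), Fin (headVector (2 * k + 3) m i), ∀ u v, G.Adj u v →
      (blowUp (SimpleGraph.cycleGraph (2 * k + 3)) (headVector (2 * k + 3) m)).Adj (e u) (e v) := by
  classical
  have : Nonempty V := Fintype.card_pos_iff.1 (by omega)
  obtain ⟨hq1, hq2⟩ := qIndex_extremal_bounds hk hm hq
  have hq0 : 0 < qIndex G := lt_trans (by positivity) hq1
  obtain ⟨f, f0, f1, fsymm, ⟨u, v, huv, fuv⟩, hf⟩ := exists_edge_weights hq0
  obtain ⟨g, c, hc⟩ := exists_isShortestOddCycle hbip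
  have hg := hc.le_of_free hfree
  have hdeg : (m : ℝ) + 2 <
      ((Finset.univ.filter (G.Adj u)).card + (Finset.univ.filter (G.Adj v)).card : ℕ) := by
    have hle : ∀ a, ∑ w with G.Adj a w, f a w ≤ (Finset.univ.filter (G.Adj a)).card := by
      intro a
      have := Finset.sum_le_card_nsmul (Finset.univ.filter (G.Adj a)) (f a) 1
        fun w hw => f1 a w (by simpa using hw)
      simpa using this
    have h1 := hf u v
    rw [fuv, mul_one] at h1
    push_cast
    linarith [hle u, hle v]
  have hdeg' : m + 2 <
      (Finset.univ.filter (G.Adj u)).card + (Finset.univ.filter (G.Adj v)).card := by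
    exact_mod_cast hdeg
  have hle := hc.card_add_card_le (by omega) huv
  -- The degree bounds give `m + 3 + g ≤ |V| + 4`, that is `g ≤ 2k + 3`.
  obtain rfl : g = 2 * k + 3 := by
    obtain ⟨a, ha⟩ := hc.odd
    omega
  obtain ⟨c', hc', hu, hv, hcov⟩ := hc.exists_cycle_of_card_eq (by omega) huv (by omega)
  obtain ⟨φ, hφ, hφc, hfib, hφu, hφv⟩ := hc'.exists_fold (by omega) huv hu hv hcov
  obtain ⟨M, -, hM1, hMf, hineq⟩ := exists_class_weights hφ f0 f1 fsymm hf
  have hM : M 1 = 1 := by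
    refine le_antisymm (hM1 1) ?_
    have := hMf u v huv (by rw [hφu, hφv]; norm_num)
    rwa [fuv, hφu] at this
  have hpos : ∀ i, 1 ≤ fibreCard φ i := fun i =>
    Finset.card_pos.2 ⟨c' i, by simp [hφc]⟩
  have hone : ∀ i, i ≠ 0 → i ≠ 1 → i ≠ 2 → i ≠ 3 → fibreCard φ i = 1 := by
    intro i h0 h1 h2 h3
    refine Finset.card_eq_one.2 ⟨c' i, ?_⟩
    ext w
    simp only [Finset.mem_filter, Finset.mem_univ, true_and, Finset.mem_singleton]
    constructor
    · rintro rfl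
      exact hfib w h0 h1 h2 h3
    · rintro rfl
      exact hφc i
  obtain ⟨i₀, hi₀, hi⟩ := exists_fibre_of_bounds hk hpos hone hcard hq1 hq2 hM1 hM hineq
  exact exists_equiv_extremal hφ hi₀ hi

end Main

end QIndex

theorem theorem1p2 {V : Type*} [Fintype V] (k n : ℕ) (hk : 2 ≤ k) (hn : 2 * k + 3 ≤ n)
    (G : SimpleGraph V) (hcard : Fintype.card V = n)
    (hfree : ∀ j : ℕ, 1 ≤ j → j ≤ k → (SimpleGraph.cycleGraph (2 * j + 1)).Free G)
    (hbip : ¬ G.IsBipartite) :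
    QIndex.qIndex G ≤
        QIndex.qIndex (QIndex.blowUp (SimpleGraph.cycleGraph (2 * k + 3))
          (QIndex.headVector (2 * k + 3) (n - 2 * k - 2))) ∧
      (QIndex.qIndex G =
          QIndex.qIndex (QIndex.blowUp (SimpleGraph.cycleGraph (2 * k + 3))
            (QIndex.headVector (2 * k + 3) (n - 2 * k - 2))) ↔
        Nonempty (G ≃g QIndex.blowUp (SimpleGraph.cycleGraph (2 * k + 3))
          (QIndex.headVector (2 * k + 3) (n - 2 * k - 2)))) := by

  have : Nonempty V := Fintype.card_pos_iff.1 (by omega)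
  have hm : 1 ≤ n - 2 * k - 2 := by omega
  -- Only a graph whose index reaches the extremal value needs work; the order on the reals then
  -- gives the bound for every graph.
  have hmono : QIndex.qIndex (QIndex.blowUp (SimpleGraph.cycleGraph (2 * k + 3))
      (QIndex.headVector (2 * k + 3) (n - 2 * k - 2))) ≤ QIndex.qIndex G →
      QIndex.qIndex G = QIndex.qIndex (QIndex.blowUp (SimpleGraph.cycleGraph (2 * k + 3))
        (QIndex.headVector (2 * k + 3) (n - 2 * k - 2))) ∧
      Nonempty (G ≃g QIndex.blowUp (SimpleGraph.cycleGraph (2 * k + 3))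
        (QIndex.headVector (2 * k + 3) (n - 2 * k - 2))) := by
    intro h
    obtain ⟨e, he⟩ :=
      QIndex.exists_equiv_extremal_of_qIndex_le hk hm (by omega) hfree hbip h
    have heq := le_antisymm (QIndex.qIndex_le_of_hom e he) h
    exact ⟨heq, ⟨⟨e, fun {a b} => QIndex.adj_iff_of_hom_of_qIndex_eq e he
      (QIndex.zeroSpreads_extremal hm) heq a b⟩⟩⟩
  refine ⟨?_, fun h => (hmono h.ge).2, ?_⟩
  · rcases le_total (QIndex.qIndex G) (QIndex.qIndex (QIndex.blowUp
      (SimpleGraph.cycleGraph (2 * k + 3)) (QIndex.headVector (2 * k + 3) (n - 2 * k - 2)))) with h | h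
    · exact h
    · exact (hmono h).1.le
  · rintro ⟨e⟩
    have : Nonempty (Σ i : Fin (2 * k + 3),
      Fin (QIndex.headVector (2 * k + 3) (n - 2 * k - 2) i)) := e.toEquiv.symm.nonempty
    exact le_antisymm (QIndex.qIndex_le_of_hom e.toEquiv fun a b => e.map_adj_iff.2)
      (QIndex.qIndex_le_of_hom e.symm.toEquiv fun a b => e.symm.map_adj_iff.2)
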